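/- **Conventions.** Let $d\ge 2$ and $f:\{0,1\}^d\to\{0,1\}$. The sensitivity of $f$ is $S(f)=\max_{x}\,|\{i\in[d] : f(x)\ne f(x^{\oplus i})\}|$, where $x^{\oplus i}$ is $x$ with its $i$-th coordinate flipped. A decision tree $T$ over $d$ Boolean features queries no feature twice along a path, so a node of $T$ is specified by the restriction $\rho:[d]\rightharpoonup\{0,1\}$ recording the features queried on the way to it and their values. An *implicit decision tree* with underlying tree $T$ consists of two randomized operations that access $f$ only through queries $x\mapsto f(x)$ (and do not otherwise depend on $f$), and which, for a node $\rho$ of $T$ and auxiliary information $A\subseteq[d]$, behave as follows: * $\mathrm{IsLeaf}_f(\rho,A)$ tells whether $\rho$ is a leaf of $T$; * $\mathrm{Query}_f(\rho,A)$, for a non-leaf $\rho$, returns the feature $i\in[d]$ queried at $\rho$ in $T$ and updated auxiliary information $A'\subseteq[d]$. Here $A$ is arbitrary at the root, and at any other node it is the auxiliary information returned by the call of $\mathrm{Query}_f$ at its parent. **Lemma (exact implicit decision trees for monotone models).** There is a constant $a\in\mathbb N$, and for every $c\in\mathbb N$ a constant $K$, such that for every $d\ge 2$ there are operations $\mathrm{IsLeaf}$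 and $\mathrm{Query}$ as above with the following property. For every monotone $f:\{0,1\}^d\to\{0,1\}$ there is a decision tree $T$ such that 1. $T$ computes $f$ exactly, i.e. $T(x)=f(x)$ for all $x\in\{0,1\}^d$; 2. $T$ has depth at most $S(f)^{a}$; 3. the operations, given query access to $f$, form an implicit decision tree with underlying tree $T$; 4. each call of $\mathrm{IsLeaf}_f$ at a node of $T$, and of $\mathrm{Query}_f$ at a non-leaf node of $T$, makes at most $K\cdot\max(1,S(f))^{a}\cdot\log d$ queries to $f$ with probability at least $1-d^{-c}$. -/

import Mathlib

noncomputable section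

/-- Sensitivity of `f` at `x`: the number of features `i` for which some way of changing `x i`
changes the value of `f`. -/
def sensitivityAt {d : ℕ} (f : (Fin d → Bool) → Bool) (x : Fin d → Bool) : ℕ :=
  (Finset.univ.filter fun i : Fin d => ∃ a : Bool, f x ≠ f (Function.update x i a)).card

/-- Sensitivity `S(f)`: the maximum over all instances. -/
def sensitivity {d : ℕ} (f : (Fin d → Bool) → Bool) : ℕ :=
  Finset.univ.sup (sensitivityAt f)

/-- Restrictions: partial functions from features to `{0,1}`. -/
abbrev Restriction (d : ℕ) : Type := Fin d → Option Bool

/-- Decision trees over `d` Boolean features. In `node i t₀ t₁` the feature `i` is queried,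
`t₀` is the subtree for the answer `0` and `t₁` the one for the answer `1`. -/
inductive DecTree (d : ℕ) : Type
  | leaf (b : Bool) : DecTree d
  | node (i : Fin d) (t₀ t₁ : DecTree d) : DecTree d

namespace DecTree

variable {d : ℕ}

def eval : DecTree d → (Fin d → Bool) → Bool
  | leaf b, _ => b
  | node i t₀ t₁, x => if x i then t₁.eval x else t₀.eval x

/-- Maximal number of features queried on a root-to-leaf path. -/
def depth : DecTree d → ℕ
  | leaf _ => 0
  | node _ t₀ t₁ => max t₀.depth t₁.depth + 1

def isLeaf : DecTree d → Bool
  | leaf _ => true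
  | node _ _ _ => false

/-- The features that are queried somewhere in the tree. -/
def features : DecTree d → Finset (Fin d)
  | leaf _ => ∅
  | node i t₀ t₁ => insert i (t₀.features ∪ t₁.features)

/-- No feature is queried twice along a path, so that every node is specified by the restriction
made of the features queried on the way to it and their values. -/
def ReadOnce : DecTree d → Prop
  | leaf _ => True
  | node i t₀ t₁ => i ∉ t₀.features ∧ i ∉ t₁.features ∧ t₀.ReadOnce ∧ t₁.ReadOnce

/-- The tree represents `f` exactly. -/
def Computes (T : DecTree d) (f : (Fin d → Bool) → Bool) : Prop :=
  ∀ x, T.eval x = f x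

end DecTree

/-- Deterministic algorithms with query access to an unknown function `{0,1}^d → {0,1}` and output
in `α`: either output a value, or query an instance `x` and continue according to the answer. -/
inductive QueryAlg (d : ℕ) (α : Type) : Type
  | output (a : α) : QueryAlg d α
  | ask (x : Fin d → Bool) (next : Bool → QueryAlg d α) : QueryAlg d α

namespace QueryAlg

variable {d : ℕ} {α : Type}

/-- The output when the queries are answered by `f`. -/
def run (f : (Fin d → Bool) → Bool) : QueryAlg d α → α
  | output a => a
  | ask x next => (next (f x)).run f

/-- The number of queries made (with repetitions) when they are answered by `f`. -/
def cost (f : (Fin d → Bool) → Bool) : QueryAlg d α → ℕ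
  | output _ => 0
  | ask x next => (next (f x)).cost f + 1

end QueryAlg

/-- A randomized algorithm with query access: a probability distribution on deterministic ones. -/
abbrev RandQueryAlg (d : ℕ) (α : Type) : Type := PMF (QueryAlg d α)

/-- The probability that the randomized algorithm makes at most `q` queries to `f`. -/
def RandQueryAlg.probCostLE {d : ℕ} {α : Type} (P : RandQueryAlg d α)
    (f : (Fin d → Bool) → Bool) (q : ℝ) : ℝ :=
  (P.toOuterMeasure {p | (p.cost f : ℝ) ≤ q}).toReal

/-- The two operations of an implicit decision tree. They receive a restriction and auxiliary
information (a set of features), and can access the function only through queries: the same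
operations are used for every function on `{0,1}^d`. -/
structure ImplicitTree (d : ℕ) where
  isLeaf : Restriction d → Finset (Fin d) → RandQueryAlg d Bool
  query : Restriction d → Finset (Fin d) → RandQueryAlg d (Fin d × Finset (Fin d))

namespace ImplicitTree

variable {d : ℕ}

/-- `I.Reaches f T t ρ A`: in a walk down the tree `T` with the operations `I` on the function `f`,
the node of `T` with restriction `ρ`, at which the subtree `t` is rooted, can be reached with
auxiliary information `A`. The walk starts at the root with arbitrary auxiliary information, and
both children of a node inherit the auxiliary information that a run of `query` (for some outcome
of its randomness) returned at that node. -/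
inductive Reaches (I : ImplicitTree d) (f : (Fin d → Bool) → Bool) (T : DecTree d) :
    DecTree d → Restriction d → Finset (Fin d) → Prop
  | root (A : Finset (Fin d)) : Reaches I f T T (fun _ => none) A
  | step (i : Fin d) (t₀ t₁ : DecTree d) (ρ : Restriction d) (A A' : Finset (Fin d))
      (p : QueryAlg d (Fin d × Finset (Fin d))) (b : Bool) :
      Reaches I f T (DecTree.node i t₀ t₁) ρ A →
      p ∈ (I.query ρ A).support →
      p.run f = (i, A') →
      Reaches I f T (if b then t₁ else t₀) (Function.update ρ i (some b)) A'

/-- `I` is an implicit decision tree for `f`, with underlying tree `T`: at every node and with every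
auxiliary information that can occur there, `isLeaf` tells whether the node is a leaf of `T` and,
if it is not, `query` returns the feature queried there in `T`. -/
def Navigates (I : ImplicitTree d) (f : (Fin d → Bool) → Bool) (T : DecTree d) : Prop :=
  ∀ t ρ A, I.Reaches f T t ρ A →
    (∀ p ∈ (I.isLeaf ρ A).support, p.run f = t.isLeaf) ∧
    ∀ i t₀ t₁, t = DecTree.node i t₀ t₁ →
      ∀ p ∈ (I.query ρ A).support, (p.run f).1 = i

/-- Each operation, called at a node of `T`, makes at most `q` queries to `f` except with
probability at most `δ`. -/
def UsesAtMost (I : ImplicitTree d) (f : (Fin d → Bool) → Bool) (T : DecTree d)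
    (q δ : ℝ) : Prop :=
  ∀ t ρ A, I.Reaches f T t ρ A →
    1 - δ ≤ (I.isLeaf ρ A).probCostLE f q ∧
    (t.isLeaf = false → 1 - δ ≤ (I.query ρ A).probCostLE f q)

end ImplicitTree

end

noncomputable section

/-! ### Sequencing of query algorithms; binary search. -/

namespace QueryAlg

variable {d : ℕ} {α β : Type}

/-! The tree repeatedly takes a minterm of the restricted function and queries all its features,
until the restriction is constant. Let s = S(f). A minterm has at most s features, since each is
sensitive at its indicator. Every zero has a 0-certificate of size at most s
(`exists_zero_certificate`), and a minterm meets every 0-certificate, so each round removes a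
feature from all of them (`Within.minterm`). Hence there are at most s rounds and s² queries on a
path. A minterm is found by one binary search per feature, about s log d queries
(`extendMinterm_spec`). The auxiliary set stores the unqueried rest of the current minterm. All
operations are deterministic, so the bounds hold with probability 1. -/

def bind : QueryAlg d α → (α → QueryAlg d β) → QueryAlg d β
  | output a, g => g a
  | ask x next, g => ask x fun b => (next b).bind g

theorem run_bind (f : (Fin d → Bool) → Bool) (p : QueryAlg d α) (g : α → QueryAlg d β) :
    (p.bind g).run f = (g (p.run f)).run f := by
  induction p with
  | output a => rfl
  | ask x next ih => exact ih (f x)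

theorem cost_bind (f : (Fin d → Bool) → Bool) (p : QueryAlg d α) (g : α → QueryAlg d β) :
    (p.bind g).cost f = p.cost f + (g (p.run f)).cost f := by
  induction p with
  | output a => simp [bind, cost, run]
  | ask x next ih =>
    have := ih (f x)
    simp only [bind, cost, run] at this ⊢
    omega

/-- Binary search for a position at which the answer along `probe` drops from `true` to `false`. -/
def binarySearch (probe : ℕ → Fin d → Bool) : ℕ → ℕ → ℕ → QueryAlg d ℕ
  | 0, lo, _ => output lo
  | n + 1, lo, hi => ask (probe ((lo + hi) / 2)) fun b =>
      if b then binarySearch probe n ((lo + hi) / 2) hi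
      else binarySearch probe n lo ((lo + hi) / 2)

theorem cost_binarySearch (f : (Fin d → Bool) → Bool) (probe : ℕ → Fin d → Bool) (n : ℕ) :
    ∀ lo hi, (binarySearch probe n lo hi).cost f = n := by
  induction n with
  | zero => intro lo hi; rfl
  | succ n ih =>
    intro lo hi
    cases h : f (probe ((lo + hi) / 2)) <;> simp [binarySearch, cost, h, ih]

/-- Each step keeps the value `true` at `lo` and `false` at `hi` while halving the bound on the gap;
the probes need not be monotone. -/
theorem run_binarySearch (f : (Fin d → Bool) → Bool) (probe : ℕ → Fin d → Bool) (n : ℕ) :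
    ∀ lo hi, lo ≤ hi → hi ≤ lo + 2 ^ n → f (probe lo) = true → f (probe hi) = false →
      lo ≤ (binarySearch probe n lo hi).run f ∧ (binarySearch probe n lo hi).run f < hi ∧
      f (probe ((binarySearch probe n lo hi).run f)) = true ∧
      f (probe ((binarySearch probe n lo hi).run f + 1)) = false := by
  induction n with
  | zero =>
    intro lo hi hle hlen hlo hhi
    have hne : lo ≠ hi := by rintro rfl; simp_all
    obtain rfl : hi = lo + 1 := by simp at hlen; omega
    exact ⟨le_rfl, Nat.lt_succ_self _, hlo, hhi⟩
  | succ n ih =>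
    intro lo hi hle hlen hlo hhi
    rw [pow_succ] at hlen
    cases h : f (probe ((lo + hi) / 2))
    · obtain ⟨h1, h2, h3⟩ := ih lo ((lo + hi) / 2) (by omega) (by omega) hlo h
      simp only [binarySearch, run, h, Bool.false_eq_true, if_false]
      exact ⟨h1, by omega, h3⟩
    · obtain ⟨h1, h2, h3⟩ := ih ((lo + hi) / 2) hi (by omega) (by omega) h hhi
      simp only [binarySearch, run, h, if_true]
      exact ⟨by omega, h2, h3⟩

end QueryAlg

/-! ### Minterms and 0-certificates. -/

section Monotone

variable {d : ℕ}

/-- The instance that agrees with `ρ` on its domain and elsewhere is the indicator of `S`. -/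
def complete (ρ : Restriction d) (S : Finset (Fin d)) : Fin d → Bool :=
  fun i => (ρ i).getD (decide (i ∈ S))

theorem complete_mono (ρ : Restriction d) : Monotone (complete ρ) := by
  intro S S' h i
  cases hi : ρ i with
  | some b => simp [complete, hi]
  | none =>
    simp only [complete, hi, Option.getD_none]
    by_cases hS : i ∈ S
    · simp [hS, h hS]
    · simp [hS]

theorem Monotone.eq_true_of_le {f : (Fin d → Bool) → Bool} (hf : Monotone f) {x y : Fin d → Bool}
    (h : x ≤ y) (hx : f x = true) : f y = true := by
  have := hf h
  rw [hx] at this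
  exact top_le_iff.1 this

theorem Monotone.eq_false_of_le {f : (Fin d → Bool) → Bool} (hf : Monotone f) {x y : Fin d → Bool}
    (h : x ≤ y) (hy : f y = false) : f x = false := by
  by_contra hx
  have := hf.eq_true_of_le h (by simpa using hx)
  simp_all

theorem card_le_sensitivity {f : (Fin d → Bool) → Bool} (x : Fin d → Bool) (S : Finset (Fin d))
    (h : ∀ i ∈ S, ∃ a, f x ≠ f (Function.update x i a)) : S.card ≤ sensitivity f := by
  refine le_trans (Finset.card_le_card ?_)
    (Finset.le_sup (f := sensitivityAt f) (Finset.mem_univ x))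
  intro i hi
  simpa using h i hi

/-- `S` is a minterm of the restriction of `f` by `ρ`. -/
def IsMinterm (f : (Fin d → Bool) → Bool) (ρ : Restriction d) (S : Finset (Fin d)) : Prop :=
  f (complete ρ S) = true ∧ ∀ i ∈ S, f (complete ρ (S.erase i)) = false

namespace IsMinterm

variable {f : (Fin d → Bool) → Bool} {ρ : Restriction d} {S : Finset (Fin d)}

/-- Erasing a feature already fixed by `ρ` would not change the instance. -/
theorem eq_none (h : IsMinterm f ρ S) {i : Fin d} (hi : i ∈ S) : ρ i = none := by
  by_contra hne
  have : complete ρ (S.erase i) = complete ρ S := by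
    funext j
    by_cases hj : j = i
    · subst hj
      obtain ⟨b, hb⟩ := Option.ne_none_iff_exists'.1 hne
      simp [complete, hb]
    · simp [complete, hj]
  have h2 := h.2 i hi
  rw [this, h.1] at h2
  simp at h2

theorem card_le (h : IsMinterm f ρ S) : S.card ≤ sensitivity f := by
  refine card_le_sensitivity (complete ρ S) S fun i hi => ⟨false, ?_⟩
  have : Function.update (complete ρ S) i false = complete ρ (S.erase i) := by
    funext j
    by_cases hj : j = i
    · subst hj
      simp [complete, h.eq_none hi]
    · simp [complete, hj]
  rw [this, h.1, h.2 i hi]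
  simp

end IsMinterm

/-- Every zero `z` of `f` vanishes on a set of features, of size at most the sensitivity, whose
co-indicator is a zero too: for monotone `f` this is a 0-certificate. -/
theorem exists_zero_certificate {f : (Fin d → Bool) → Bool} (z : Fin d → Bool)
    (hz : f z = false) :
    ∃ S : Finset (Fin d), (∀ i ∈ S, z i = false) ∧ f (fun i => decide (i ∉ S)) = false ∧
      S.card ≤ sensitivity f := by
  -- At a maximal zero `y` above `z`, every coordinate with value 0 is sensitive.
  obtain ⟨y, hzy, hy⟩ := (Set.toFinite {y | f y = false}).exists_le_maximal hz
  refine ⟨Finset.univ.filter fun i => y i = false, ?_, ?_, ?_⟩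
  · intro i hi
    have h1 := hzy i
    rw [(Finset.mem_filter.1 hi).2] at h1
    exact le_bot_iff.1 h1
  · have : (fun i => decide (i ∉ Finset.univ.filter fun i => y i = false)) = y := by
      funext i
      simp
    rw [this]
    exact hy.prop
  · refine card_le_sensitivity y _ fun i hi => ⟨true, ?_⟩
    have hyi : y i = false := (Finset.mem_filter.1 hi).2
    have hyf : f y = false := hy.prop
    rw [hyf]
    intro h
    have hle : y ≤ Function.update y i true := by
      intro j
      by_cases hj : j = i
      · subst hj; simp
      · simp [hj]
    have := hy.le_of_ge (y := Function.update y i true) h.symm hle i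
    rw [hyi, Function.update_self] at this
    exact Bool.false_ne_true (top_le_iff.1 this)

/-! ### Finding a minterm with few queries. -/

section Search

/-- The features with index at least `k`. -/
def indicesFrom (d k : ℕ) : Finset (Fin d) :=
  Finset.univ.filter fun i => k ≤ i.val

/-- Adjoins the feature with index `j`, if there is one. -/
def insertIndex (j : ℕ) (C : Finset (Fin d)) : Finset (Fin d) :=
  if h : j < d then insert ⟨j, h⟩ C else C

/-- Extends a set `C` of features that all belong to a minterm by the features of index at least
`k`, one binary search for each. -/
def extendMinterm (ρ : Restriction d) : ℕ → Finset (Fin d) → ℕ → QueryAlg d (Finset (Fin d))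
  | 0, C, _ => .output C
  | n + 1, C, k => .ask (complete ρ C) fun b =>
      if b then .output C
      else (QueryAlg.binarySearch (fun j => complete ρ (C ∪ indicesFrom d j))
        (Nat.log 2 d + 1) k d).bind fun j => extendMinterm ρ n (insertIndex j C) (j + 1)

/-- Invariant: `C` with the tail from `k` gives a one, and every feature of `C` is indispensable in
it. The search finds an index whose removal from the tail destroys the one, so that feature joins
`C`. In the cost, each new feature pays for one test and one search, `Nat.log 2 d + 2` queries in
all; the extra 1 is the final test. -/
theorem extendMinterm_spec {f : (Fin d → Bool) → Bool} (hf : Monotone f) (ρ : Restriction d)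
    (n : ℕ) : ∀ (C : Finset (Fin d)) (k : ℕ), k ≤ d → d ≤ k + n →
      f (complete ρ (C ∪ indicesFrom d k)) = true →
      (∀ c ∈ C, f (complete ρ (C.erase c ∪ indicesFrom d k)) = false) →
      IsMinterm f ρ ((extendMinterm ρ n C k).run f) ∧
      (extendMinterm ρ n C k).cost f + C.card * (Nat.log 2 d + 2) ≤
        ((extendMinterm ρ n C k).run f).card * (Nat.log 2 d + 2) + 1 := by
  have hempty : indicesFrom d d = ∅ := by
    ext i
    simp [indicesFrom]
  induction n with
  | zero =>
    intro C k hk hn hC hcrit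
    obtain rfl : k = d := by omega
    simp only [hempty, Finset.union_empty] at hC hcrit
    simp [extendMinterm, QueryAlg.run, QueryAlg.cost, IsMinterm, hC]
    exact hcrit
  | succ n ih =>
    intro C k hk hn hC hcrit
    cases hb : f (complete ρ C)
    · simp only [extendMinterm, QueryAlg.run, QueryAlg.cost, hb, Bool.false_eq_true, if_false,
        QueryAlg.run_bind, QueryAlg.cost_bind, QueryAlg.cost_binarySearch]
      have hd : d ≤ k + 2 ^ (Nat.log 2 d + 1) :=
        (Nat.lt_pow_succ_log_self one_lt_two d).le.trans (Nat.le_add_left _ _)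
      obtain ⟨h1, h2, h3, h4⟩ := QueryAlg.run_binarySearch f
        (fun j => complete ρ (C ∪ indicesFrom d j)) (Nat.log 2 d + 1) k d hk hd hC
        (by simpa [hempty] using hb)
      generalize (QueryAlg.binarySearch (fun j => complete ρ (C ∪ indicesFrom d j))
        (Nat.log 2 d + 1) k d).run f = j at h1 h2 h3 h4 ⊢
      have hins : insertIndex j C = insert ⟨j, h2⟩ C := by simp [insertIndex, h2]
      -- Otherwise dropping `j` from the tail would not change the union, yet the value drops there.
      have hj : (⟨j, h2⟩ : Fin d) ∉ C := by
        intro hj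
        have hsub : C ∪ indicesFrom d j ⊆ C ∪ indicesFrom d (j + 1) := by
          intro i hi
          rcases Finset.mem_union.1 hi with hi | hi
          · exact Finset.mem_union_left _ hi
          · by_cases hij : i = ⟨j, h2⟩
            · exact Finset.mem_union_left _ (hij ▸ hj)
            · refine Finset.mem_union_right _ ?_
              simp only [indicesFrom, Finset.mem_filter, Finset.mem_univ, true_and, Fin.ext_iff]
                at hi hij ⊢
              omega
        have := hf.eq_true_of_le (complete_mono ρ hsub) h3
        exact Bool.false_ne_true (h4.symm.trans this)
      rw [hins]
      have hC' : f (complete ρ (insert ⟨j, h2⟩ C ∪ indicesFrom d (j + 1))) = true := by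
        refine hf.eq_true_of_le (complete_mono ρ ?_) h3
        intro i hi
        simp only [indicesFrom, Finset.mem_union, Finset.mem_filter, Finset.mem_univ, true_and,
          Finset.mem_insert, Fin.ext_iff] at hi ⊢
        by_cases hiC : i ∈ C
        · simp [hiC]
        · simp only [hiC, or_false, false_or] at hi ⊢
          omega
      have hcrit' : ∀ c ∈ insert ⟨j, h2⟩ C,
          f (complete ρ ((insert ⟨j, h2⟩ C).erase c ∪ indicesFrom d (j + 1))) = false := by
        intro c hc
        rcases Finset.mem_insert.1 hc with rfl | hc
        · rw [Finset.erase_insert hj]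
          exact h4
        · refine hf.eq_false_of_le (complete_mono ρ ?_) (hcrit c hc)
          intro i hi
          simp only [indicesFrom, Finset.mem_union, Finset.mem_filter, Finset.mem_univ, true_and,
            Finset.mem_insert, Finset.mem_erase, Fin.ext_iff] at hi ⊢
          by_cases hiC : i ∈ C
          · simp only [hiC, or_true, and_true] at hi ⊢
            omega
          · simp only [hiC, or_false, and_false, false_or] at hi ⊢
            omega
      obtain ⟨hmin, hcost⟩ := ih _ (j + 1) (by omega) (by omega) hC' hcrit'
      refine ⟨hmin, ?_⟩
      rw [Finset.card_insert_of_notMem hj, add_one_mul] at hcost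
      omega
    · simp only [extendMinterm, QueryAlg.run, QueryAlg.cost, hb, if_true]
      exact ⟨⟨hb, fun c hc => hf.eq_false_of_le
        (complete_mono ρ Finset.subset_union_left) (hcrit c hc)⟩, by omega⟩

/-- Finds a minterm of the restriction of a monotone function by `ρ`. -/
def findMinterm (ρ : Restriction d) : QueryAlg d (Finset (Fin d)) :=
  extendMinterm ρ d ∅ 0

theorem findMinterm_spec {f : (Fin d → Bool) → Bool} (hf : Monotone f) (ρ : Restriction d)
    (h : f (complete ρ Finset.univ) = true) :
    IsMinterm f ρ ((findMinterm ρ).run f) ∧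
      (findMinterm ρ).cost f ≤ ((findMinterm ρ).run f).card * (Nat.log 2 d + 2) + 1 := by
  have := extendMinterm_spec hf ρ d ∅ 0 (Nat.zero_le _) (by omega)
    (by simpa [indicesFrom] using h) (by simp)
  simpa [findMinterm] using this

end Search

/-! ### The operations and the tree they navigate. -/

/-- The features to be queried next according to the auxiliary information, which is meaningless
at the root. -/
def pending (ρ : Restriction d) (A : Finset (Fin d)) : Finset (Fin d) :=
  if ∀ i, ρ i = none then ∅ else A

/-- The pending features or, if there are none, those of a new minterm. -/
def refresh (ρ : Restriction d) (A : Finset (Fin d)) : QueryAlg d (Finset (Fin d)) :=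
  if pending ρ A = ∅ then findMinterm ρ else .output (pending ρ A)

/-- Splits off the least feature. -/
def splitLeast (hd : 0 < d) (C : Finset (Fin d)) : Fin d × Finset (Fin d) :=
  if h : C.Nonempty then (C.min' h, C.erase (C.min' h)) else (⟨0, hd⟩, ∅)

def mintermQuery (hd : 0 < d) (ρ : Restriction d) (A : Finset (Fin d)) :
    QueryAlg d (Fin d × Finset (Fin d)) :=
  (refresh ρ A).bind fun C => .output (splitLeast hd C)

/-- A monotone function is constant on a subcube iff it agrees on its least and greatest
instances. -/
def constancyTest (ρ : Restriction d) : QueryAlg d Bool :=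
  .ask (complete ρ ∅) fun b => .ask (complete ρ Finset.univ) fun b' => .output (b == b')

def mintermOperations (hd : 0 < d) : ImplicitTree d where
  isLeaf ρ _ := PMF.pure (constancyTest ρ)
  query ρ A := PMF.pure (mintermQuery hd ρ A)

/-- The tree of height at most `n` that is navigated by `mintermOperations`. -/
def mintermTree (hd : 0 < d) (f : (Fin d → Bool) → Bool) :
    ℕ → Restriction d → Finset (Fin d) → DecTree d
  | 0, ρ, _ => .leaf (f (complete ρ Finset.univ))
  | n + 1, ρ, A =>
    if f (complete ρ ∅) = f (complete ρ Finset.univ) then .leaf (f (complete ρ Finset.univ))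
    else
      .node ((mintermQuery hd ρ A).run f).1
        (mintermTree hd f n (Function.update ρ ((mintermQuery hd ρ A).run f).1 (some false))
          ((mintermQuery hd ρ A).run f).2)
        (mintermTree hd f n (Function.update ρ ((mintermQuery hd ρ A).run f).1 (some true))
          ((mintermQuery hd ρ A).run f).2)

theorem depth_mintermTree (hd : 0 < d) (f : (Fin d → Bool) → Bool) (n : ℕ) :
    ∀ ρ A, (mintermTree hd f n ρ A).depth ≤ n := by
  induction n with
  | zero => intro ρ A; simp [mintermTree, DecTree.depth]
  | succ n ih =>
    intro ρ A
    rw [mintermTree]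
    split_ifs
    · simp [DecTree.depth]
    · simp only [DecTree.depth]
      have := ih (Function.update ρ ((mintermQuery hd ρ A).run f).1 (some false))
        ((mintermQuery hd ρ A).run f).2
      have := ih (Function.update ρ ((mintermQuery hd ρ A).run f).1 (some true))
        ((mintermQuery hd ρ A).run f).2
      omega

/-- Since `pending` discards the auxiliary set at the root, the arbitrary initial set of a walk is
harmless. -/
theorem mintermTree_root (hd : 0 < d) (f : (Fin d → Bool) → Bool) (n : ℕ)
    (A A' : Finset (Fin d)) :
    mintermTree hd f n (fun _ => none) A = mintermTree hd f n (fun _ => none) A' := by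
  cases n <;> simp [mintermTree, mintermQuery, refresh, pending]

/-! ### The query budget as an invariant. -/

def Extends (z : Fin d → Bool) (ρ : Restriction d) : Prop :=
  ∀ i b, ρ i = some b → z i = b

theorem Extends.of_update {z : Fin d → Bool} {ρ : Restriction d} {i : Fin d} {b : Bool}
    (h : Extends z (Function.update ρ i (some b))) (hi : ρ i = none) : Extends z ρ := by
  intro j c hj
  refine h j c ?_
  rw [Function.update_of_ne]
  · exact hj
  · rintro rfl
    simp_all

theorem extends_complete (ρ : Restriction d) (S : Finset (Fin d)) :
    Extends (complete ρ S) ρ := by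
  intro i b h
  simp [complete, h]

theorem Extends.complete_empty_le {z : Fin d → Bool} {ρ : Restriction d} (h : Extends z ρ) :
    complete ρ ∅ ≤ z := by
  intro i
  cases hi : ρ i with
  | none => simp [complete, hi]
  | some b => simp [complete, hi, h i b hi]

theorem Extends.le_complete_univ {z : Fin d → Bool} {ρ : Restriction d} (h : Extends z ρ) :
    z ≤ complete ρ Finset.univ := by
  intro i
  cases hi : ρ i with
  | none => simp [complete, hi, Bool.le_true]
  | some b => simp [complete, hi, h i b hi]

/-- With at most `n` further queries on each path, starting with the features of `A`, the minterm
strategy determines `f`: every zero has a 0-certificate with at most `k` features outside `A`,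
and each new minterm meets all of them. -/
def Within (f : (Fin d → Bool) → Bool) (n : ℕ) (ρ : Restriction d) (A : Finset (Fin d)) : Prop :=
  (∀ i ∈ A, ρ i = none) ∧
  ∃ k, A.card + sensitivity f * k ≤ n ∧
    ∀ z, Extends z ρ → f z = false →
      ∃ S : Finset (Fin d), (∀ i ∈ S, ρ i = none ∧ z i = false) ∧
        f (complete ρ Sᶜ) = false ∧ (S \ A).card ≤ k

theorem within_root (f : (Fin d → Bool) → Bool) :
    Within f (sensitivity f ^ 2) (fun _ => none) ∅ := by
  refine ⟨by simp, sensitivity f, by simp [sq], fun z _ hz => ?_⟩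
  obtain ⟨S, h1, h2, h3⟩ := exists_zero_certificate z hz
  refine ⟨S, fun i hi => ⟨rfl, h1 i hi⟩, ?_, by simpa using h3⟩
  convert h2 using 2
  funext i
  simp [complete]

/-- The query is paid for by the decrease of `A.card`; `k` stays the same because `i ∈ A` does not
count in `S \ A`. -/
theorem Within.erase {f : (Fin d → Bool) → Bool} (hf : Monotone f) {n : ℕ} {ρ : Restriction d}
    {A : Finset (Fin d)} (h : Within f (n + 1) ρ A) {i : Fin d} (hi : i ∈ A) (b : Bool) :
    Within f n (Function.update ρ i (some b)) (A.erase i) := by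
  obtain ⟨hfree, k, hk, hcert⟩ := h
  refine ⟨fun j hj => ?_, k, ?_, fun z hz hfz => ?_⟩
  · rw [Finset.mem_erase] at hj
    rw [Function.update_of_ne hj.1]
    exact hfree j hj.2
  · have := Finset.card_erase_add_one hi
    omega
  · obtain ⟨S, h1, h2, h3⟩ := hcert z (hz.of_update (hfree i hi)) hfz
    have hzi : z i = b := hz i b (by simp)
    refine ⟨S.erase i, fun j hj => ?_, ?_, ?_⟩
    · rw [Finset.mem_erase] at hj
      rw [Function.update_of_ne hj.1]
      exact h1 j hj.2
    -- If `i ∈ S`, then `z` forces `b = false`, the value already present; if `i ∉ S`, the old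
    -- instance has the value 1 at `i`.
    · refine hf.eq_false_of_le ?_ h2
      intro j
      by_cases hj : j = i
      · subst hj
        by_cases hS : j ∈ S
        · have : b = false := hzi.symm.trans (h1 j hS).2
          simp [complete, this]
        · simp [complete, hS, hfree j hi, Bool.le_true]
      · simp [complete, hj]
    · refine (Finset.card_le_card ?_).trans h3
      intro j hj
      simp only [Finset.mem_sdiff, Finset.mem_erase] at hj ⊢
      tauto

/-- A minterm disjoint from a 0-certificate `S` would lie in `Sᶜ` and force the value 1 there. So
`k` drops by one, which frees `sensitivity f` units of budget, enough for `C`. -/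
theorem Within.minterm {f : (Fin d → Bool) → Bool} (hf : Monotone f) {n : ℕ} {ρ : Restriction d}
    {C : Finset (Fin d)} (h : Within f n ρ ∅) (hC : IsMinterm f ρ C)
    (hzero : f (complete ρ ∅) = false) : Within f n ρ C := by
  obtain ⟨-, k, hk, hcert⟩ := h
  have hmeet : ∀ S : Finset (Fin d), f (complete ρ Sᶜ) = false → (S \ C).card + 1 ≤ S.card := by
    intro S hS
    refine Finset.card_lt_card ⟨Finset.sdiff_subset, fun hsub => ?_⟩
    have hCS : C ⊆ Sᶜ := by
      intro i hi
      rw [Finset.mem_compl]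
      intro hiS
      exact (Finset.mem_sdiff.1 (hsub hiS)).2 hi
    have := hf.eq_true_of_le (complete_mono ρ hCS) hC.1
    simp_all
  -- The certificate of the zero `complete ρ ∅` meets `C`, so it is nonempty.
  have hk0 : k ≠ 0 := by
    rintro rfl
    obtain ⟨S, -, h2, h3⟩ := hcert _ (extends_complete ρ ∅) hzero
    have := hmeet S h2
    simp_all
  obtain ⟨m, rfl⟩ := Nat.exists_eq_succ_of_ne_zero hk0
  refine ⟨fun i hi => hC.eq_none hi, m, ?_, fun z hz hfz => ?_⟩
  · have := hC.card_le
    simp only [Finset.card_empty, zero_add, Nat.succ_eq_add_one, mul_add, mul_one] at hk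
    omega
  · obtain ⟨S, h1, h2, h3⟩ := hcert z hz hfz
    refine ⟨S, h1, h2, ?_⟩
    have := hmeet S h2
    simp at h3
    omega

theorem eq_false_and_eq_true_of_ne {f : (Fin d → Bool) → Bool} (hf : Monotone f)
    {ρ : Restriction d} (h : f (complete ρ ∅) ≠ f (complete ρ Finset.univ)) :
    f (complete ρ ∅) = false ∧ f (complete ρ Finset.univ) = true := by
  have := hf (complete_mono ρ (Finset.empty_subset Finset.univ))
  revert h this
  cases f (complete ρ ∅) <;> cases f (complete ρ Finset.univ) <;> simp

theorem refresh_spec {f : (Fin d → Bool) → Bool} (hf : Monotone f) {n : ℕ} {ρ : Restriction d}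
    {A : Finset (Fin d)} (h : Within f n ρ (pending ρ A))
    (hne : f (complete ρ ∅) ≠ f (complete ρ Finset.univ)) :
    ((refresh ρ A).run f).Nonempty ∧ Within f n ρ ((refresh ρ A).run f) ∧
      (refresh ρ A).cost f ≤ sensitivity f * (Nat.log 2 d + 2) + 1 := by
  obtain ⟨h0, h1⟩ := eq_false_and_eq_true_of_ne hf hne
  unfold refresh
  split_ifs with hA
  · rw [hA] at h
    obtain ⟨hmin, hcost⟩ := findMinterm_spec hf ρ h1
    refine ⟨?_, h.minterm hf hmin h0, hcost.trans ?_⟩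
    · rw [Finset.nonempty_iff_ne_empty]
      intro he
      have := hmin.1
      rw [he] at this
      simp_all
    · gcongr
      exact hmin.card_le
  · exact ⟨Finset.nonempty_iff_ne_empty.2 hA, h, by simp [QueryAlg.cost]⟩

theorem mintermQuery_spec (hd : 0 < d) {f : (Fin d → Bool) → Bool} (hf : Monotone f) {n : ℕ}
    {ρ : Restriction d} {A : Finset (Fin d)} (h : Within f (n + 1) ρ (pending ρ A))
    (hne : f (complete ρ ∅) ≠ f (complete ρ Finset.univ)) :
    ρ ((mintermQuery hd ρ A).run f).1 = none ∧
      ∀ b, Within f n (Function.update ρ ((mintermQuery hd ρ A).run f).1 (some b))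
        (pending (Function.update ρ ((mintermQuery hd ρ A).run f).1 (some b))
          ((mintermQuery hd ρ A).run f).2) := by
  obtain ⟨hC, hw, -⟩ := refresh_spec hf h hne
  simp only [mintermQuery, QueryAlg.run_bind, QueryAlg.run, splitLeast, hC, dif_pos]
  refine ⟨hw.1 _ (Finset.min'_mem _ hC), fun b => ?_⟩
  -- A child is never the root, so its auxiliary set is taken at face value.
  rw [pending, if_neg]
  · exact hw.erase hf (Finset.min'_mem _ hC) b
  · intro hall
    simpa using hall (((refresh ρ A).run f).min' hC)

/-- Were the restriction not constant, a nonempty set of features would have to fit into the budget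
0. This justifies the leaves where the height bound runs out. -/
theorem Within.constant_of_zero {f : (Fin d → Bool) → Bool} (hf : Monotone f)
    {ρ : Restriction d} {A : Finset (Fin d)} (h : Within f 0 ρ (pending ρ A)) :
    f (complete ρ ∅) = f (complete ρ Finset.univ) := by
  by_contra hne
  obtain ⟨hC, ⟨-, k, hk, -⟩, -⟩ := refresh_spec hf h hne
  have := hC.card_pos
  omega

/-! ### Correctness of the tree and of its navigation. -/

theorem eval_mintermTree (hd : 0 < d) {f : (Fin d → Bool) → Bool} (hf : Monotone f)
    (x : Fin d → Bool) (n : ℕ) : ∀ ρ A, Within f n ρ (pending ρ A) → Extends x ρ →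
      (mintermTree hd f n ρ A).eval x = f x := by
  have hconst : ∀ ρ, Extends x ρ → f (complete ρ ∅) = f (complete ρ Finset.univ) →
      f (complete ρ Finset.univ) = f x := by
    intro ρ hx h
    exact le_antisymm (h ▸ hf hx.complete_empty_le) (hf hx.le_complete_univ)
  induction n with
  | zero =>
    intro ρ A h hx
    exact hconst ρ hx (h.constant_of_zero hf)
  | succ n ih =>
    intro ρ A h hx
    rw [mintermTree]
    split_ifs with hc
    · exact hconst ρ hx hc
    · obtain ⟨-, hw⟩ := mintermQuery_spec hd hf h hc
      have hupd : ∀ i b, x i = b → Extends x (Function.update ρ i (some b)) := by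
        intro i b hi j c hj
        by_cases hji : j = i
        · subst hji
          simp only [Function.update_self, Option.some.injEq] at hj
          exact hi.trans hj
        · rw [Function.update_of_ne hji] at hj
          exact hx j c hj
      rw [DecTree.eval]
      split_ifs with hb
      · exact ih _ _ (hw true) (hupd _ _ hb)
      · exact ih _ _ (hw false) (hupd _ _ (by simpa using hb))

theorem readOnce_mintermTree (hd : 0 < d) {f : (Fin d → Bool) → Bool} (hf : Monotone f) (n : ℕ) :
    ∀ ρ A, Within f n ρ (pending ρ A) →
      (∀ i ∈ (mintermTree hd f n ρ A).features, ρ i = none) ∧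
        (mintermTree hd f n ρ A).ReadOnce := by
  induction n with
  | zero => intro ρ A _; simp [mintermTree, DecTree.features, DecTree.ReadOnce]
  | succ n ih =>
    intro ρ A h
    rw [mintermTree]
    split_ifs with hc
    · simp [DecTree.features, DecTree.ReadOnce]
    · obtain ⟨hi, hw⟩ := mintermQuery_spec hd hf h hc
      obtain ⟨h1, h2⟩ := ih _ _ (hw false)
      obtain ⟨h3, h4⟩ := ih _ _ (hw true)
      refine ⟨fun j hj => ?_, fun hm => ?_, fun hm => ?_, h2, h4⟩
      · simp only [DecTree.features, Finset.mem_insert, Finset.mem_union] at hj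
        by_cases hji : j = ((mintermQuery hd ρ A).run f).1
        · rw [hji]; exact hi
        · rcases hj with hj | hj | hj
          · exact absurd hj hji
          · simpa [Function.update_of_ne hji] using h1 j hj
          · simpa [Function.update_of_ne hji] using h3 j hj
      · simpa using h1 _ hm
      · simpa using h3 _ hm

/-- As `query` is a point mass, a walk carries exactly the auxiliary sets from which the tree was
built (up to the irrelevant one at the root), and the budget invariant follows it down. -/
theorem eq_mintermTree_of_reaches (hd : 0 < d) {f : (Fin d → Bool) → Bool} (hf : Monotone f)
    {t : DecTree d} {ρ : Restriction d} {A : Finset (Fin d)}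
    (h : (mintermOperations hd).Reaches f
      (mintermTree hd f (sensitivity f ^ 2) (fun _ => none) ∅) t ρ A) :
    ∃ n, t = mintermTree hd f n ρ A ∧ Within f n ρ (pending ρ A) := by
  induction h with
  | root A =>
    exact ⟨_, mintermTree_root hd f _ _ _, by simpa [pending] using within_root f⟩
  | step i t₀ t₁ ρ A A' p b _ hp hrun ih =>
    obtain ⟨n, ht, hw⟩ := ih
    obtain rfl : p = mintermQuery hd ρ A := by simpa [mintermOperations] using hp
    cases n with
    | zero => simp [mintermTree] at ht
    | succ n =>
      rw [mintermTree] at ht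
      split_ifs at ht with hc
      obtain ⟨-, hchild⟩ := mintermQuery_spec hd hf hw hc
      rw [hrun] at ht hchild
      obtain ⟨-, h0, h1⟩ := DecTree.node.inj ht
      refine ⟨n, ?_, hchild b⟩
      cases b
      · simpa using h0
      · simpa using h1

theorem isLeaf_mintermTree (hd : 0 < d) {f : (Fin d → Bool) → Bool} (hf : Monotone f) {n : ℕ}
    {ρ : Restriction d} {A : Finset (Fin d)} (h : Within f n ρ (pending ρ A)) :
    (mintermTree hd f n ρ A).isLeaf = decide (f (complete ρ ∅) = f (complete ρ Finset.univ)) := by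
  cases n with
  | zero => simp [mintermTree, DecTree.isLeaf, h.constant_of_zero hf]
  | succ n =>
    rw [mintermTree]
    split_ifs with hc <;> simp [DecTree.isLeaf, hc]

theorem navigates_mintermTree (hd : 0 < d) {f : (Fin d → Bool) → Bool} (hf : Monotone f) :
    (mintermOperations hd).Navigates f
      (mintermTree hd f (sensitivity f ^ 2) (fun _ => none) ∅) := by
  intro t ρ A h
  obtain ⟨n, rfl, hw⟩ := eq_mintermTree_of_reaches hd hf h
  refine ⟨fun p hp => ?_, fun i t₀ t₁ ht p hp => ?_⟩
  · obtain rfl : p = constancyTest ρ := by simpa [mintermOperations] using hp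
    rw [isLeaf_mintermTree hd hf hw]
    simp [constancyTest, QueryAlg.run, Bool.beq_eq_decide_eq]
  · obtain rfl : p = mintermQuery hd ρ A := by simpa [mintermOperations] using hp
    cases n with
    | zero => simp [mintermTree] at ht
    | succ n =>
      rw [mintermTree] at ht
      split_ifs at ht
      exact (DecTree.node.inj ht).1

/-! ### Query bounds. -/

theorem one_sub_le_probCostLE_pure {α : Type} {p : QueryAlg d α} {f : (Fin d → Bool) → Bool}
    {q δ : ℝ} (hδ : 0 ≤ δ) (h : (p.cost f : ℝ) ≤ q) :
    1 - δ ≤ RandQueryAlg.probCostLE (PMF.pure p) f q := by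
  simp [RandQueryAlg.probCostLE, PMF.toOuterMeasure_pure_apply, h, hδ]

/-- The summand 2 covers the constancy test. From `Real.log 2 ≥ 1/2`, `Nat.log 2 d + 2` is at most
`6 * Real.log d` and 2 at most `4 * Real.log d`; the sum 10 leaves slack below 12. -/
theorem query_bound (hd : 2 ≤ d) (s : ℕ) :
    ((s * (Nat.log 2 d + 2) + 2 : ℕ) : ℝ) ≤ 12 * ((max 1 s : ℕ) : ℝ) ^ 2 * Real.log d := by
  have hlog2 : (1 / 2 : ℝ) ≤ Real.log 2 := by linarith [Real.log_two_gt_d9]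
  have hlogd : Real.log 2 ≤ Real.log d :=
    Real.log_le_log (by norm_num) (by exact_mod_cast hd)
  have hfloor : (Nat.log 2 d : ℝ) * Real.log 2 ≤ Real.log d := by
    rw [← Real.log_pow]
    refine Real.log_le_log (by positivity) ?_
    exact_mod_cast Nat.pow_log_le_self 2 (by omega)
  have hfloor' : (Nat.log 2 d : ℝ) ≤ 2 * Real.log d := by
    nlinarith [(Nat.cast_nonneg (Nat.log 2 d) : (0 : ℝ) ≤ _)]
  have hm1 : (1 : ℝ) ≤ ((max 1 s : ℕ) : ℝ) := by exact_mod_cast le_max_left 1 s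
  have hms : (s : ℝ) ≤ ((max 1 s : ℕ) : ℝ) := by exact_mod_cast le_max_right 1 s
  generalize ((max 1 s : ℕ) : ℝ) = m at hm1 hms
  push_cast
  have hsm : (s : ℝ) ≤ m ^ 2 := by nlinarith
  have h1m : (1 : ℝ) ≤ m ^ 2 := by nlinarith
  have h1 : (s : ℝ) * (Nat.log 2 d + 2) ≤ m ^ 2 * (6 * Real.log d) :=
    mul_le_mul hsm (by linarith) (by positivity) (by positivity)
  have h2 : 1 * 2 ≤ m ^ 2 * (4 * Real.log d) :=
    mul_le_mul h1m (by linarith) (by norm_num) (by positivity)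
  have h3 : 0 ≤ m ^ 2 * Real.log d := mul_nonneg (by positivity) (by linarith)
  linarith

theorem usesAtMost_mintermTree (hd : 2 ≤ d) {f : (Fin d → Bool) → Bool} (hf : Monotone f)
    {δ : ℝ} (hδ : 0 ≤ δ) :
    (mintermOperations (by omega : 0 < d)).UsesAtMost f
      (mintermTree (by omega) f (sensitivity f ^ 2) (fun _ => none) ∅)
      (12 * ((max 1 (sensitivity f) : ℕ) : ℝ) ^ 2 * Real.log d) δ := by
  intro t ρ A h
  obtain ⟨n, rfl, hw⟩ := eq_mintermTree_of_reaches _ hf h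
  have hbound := query_bound hd (sensitivity f)
  refine ⟨one_sub_le_probCostLE_pure hδ (le_trans ?_ hbound), fun hleaf =>
    one_sub_le_probCostLE_pure hδ (le_trans ?_ hbound)⟩
  · norm_cast
    simp [constancyTest, QueryAlg.cost]
  · rw [isLeaf_mintermTree _ hf hw] at hleaf
    obtain ⟨-, -, hcost⟩ := refresh_spec hf hw (by simpa using hleaf)
    norm_cast
    simp only [mintermQuery, QueryAlg.cost_bind, QueryAlg.cost]
    omega

end Monotone

end

theorem lemma2p2 :
    ∃ a : ℕ, ∀ c : ℕ, ∃ K : ℝ, ∀ d : ℕ, 2 ≤ d →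
      ∃ I : ImplicitTree d, ∀ f : (Fin d → Bool) → Bool, Monotone f →
        ∃ T : DecTree d,
          T.ReadOnce ∧
          T.Computes f ∧
          T.depth ≤ sensitivity f ^ a ∧
          I.Navigates f T ∧
          I.UsesAtMost f T
            (K * ((max 1 (sensitivity f) : ℕ) : ℝ) ^ a * Real.log d)
            (1 / (d : ℝ) ^ c) := by
  -- The constant 12 is independent of `c`, since the operations never exceed the bound.
  refine ⟨2, fun c => ⟨12, fun d hd => ⟨mintermOperations (by omega), fun f hf => ?_⟩⟩⟩
  have hroot : Within f (sensitivity f ^ 2) (fun _ => none) (pending (fun _ => none) ∅) := by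
    simpa [pending] using within_root f
  refine ⟨mintermTree (by omega) f (sensitivity f ^ 2) (fun _ => none) ∅,
    (readOnce_mintermTree _ hf _ _ _ hroot).2, fun x => ?_, depth_mintermTree _ f _ _ _,
    navigates_mintermTree _ hf, usesAtMost_mintermTree hd hf (by positivity)⟩
  exact eval_mintermTree _ hf x _ _ _ hroot (by simp [Extends])
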